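/- All graphs are finite, simple and labelled. For a graph $G$ let $\kappa(G)$ be its number of connected components; a bridge of $G$ is an edge whose deletion increases the number of components by one; let $e_0(G)$ be the number of bridges of $G$, and let $\tilde G$ be the graph obtained from $G$ by deleting all its bridges. A set $\mathcal A$ of graphs is bridge-alterable if (i) for every $G\in\mathcal A$ and all vertices $u,v$ in distinct components of $G$, the graph $G+uv$ is in $\mathcal A$, and (ii) for every $G\in\mathcal A$ and every bridge $e$ of $G$, the graph $G\setminus e$ is in $\mathcal A$. Let $\mathcal A_n$ be the set of graphs in $\mathcal A$ with vertex set $[n]=\{1,\dots,n\}$. Let $\lambda,\nu>0$, let $f(G)\ge 0$ for each bridge-free graph $G$, and define $$\tau(G)=f(\tilde G)\,\lambda^{e_0(G)}\,\nu^{\kappa(G)},\qquad \tau(\mathcal A_n)=\sum_{G\in\mathcal A_n}\tau(G).$$ Theorem. Let $\mathcal A$ be bridge-alterable, assume that $\tau(\mathcal A_n)>0$ for all sufficiently large $n$, and for each such $n$ let $R_n$ be a random graph with $\Pr(R_n=G)=\tau(G)/\tau(\mathcal A_n)$ for each $G\in\mathcal A_n$. Then $\kappa(R_n)\le_s 1+\mathrm{Po}\left(\frac{\nu}{2\lambda}\right)$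 asymptotically, that is, if $Y$ is a Poisson random variable with mean $\frac{\nu}{2\lambda}$, then for each fixed $t\ge 0$ $$\limsup_{n\to\infty}\Pr(\kappa(R_n)\ge t)\le\Pr(1+Y\ge t).$$ Moreover $$\liminf_{n\to\infty}\Pr(R_n\text{ is connected})\ge e^{-\frac{\nu}{2\lambda}}\qquad\text{and}\qquad \limsup_{n\to\infty}\mathbb E[\kappa(R_n)]\le 1+\frac{\nu}{2\lambda}.$$ -/

import Mathlib

open MeasureTheory ProbabilityTheory Filter
open scoped ENNReal NNReal

namespace BridgeGraph

/-- A set of (labelled) graphs, given through its slices: `A n` is the set of its members on the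
vertex set of size `n`.  No closure under isomorphism is required. -/
abbrev GraphSet : Type := (n : ℕ) → Set (SimpleGraph (Fin n))

/-- The set of bridges of `G`: the edges of `G` whose deletion disconnects their end vertices.
(Mathlib's `IsBridge` does not include that `e` is an edge of `G`.) -/
def bridgeSet {V : Type*} (G : SimpleGraph V) : Set (Sym2 V) :=
  {e | e ∈ G.edgeSet ∧ G.IsBridge e}

/-- `G̃`: the graph obtained from `G` by removing all bridges of `G`. -/
def removeBridges {V : Type*} (G : SimpleGraph V) : SimpleGraph V :=
  G.deleteEdges (bridgeSet G)

/-- `e₀(G)`: the number of bridges of `G`. -/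
noncomputable def numBridges {V : Type*} (G : SimpleGraph V) : ℕ :=
  (bridgeSet G).ncard

/-- `κ(G)`: the number of connected components of `G`. -/
noncomputable def numComponents {V : Type*} (G : SimpleGraph V) : ℕ :=
  Nat.card G.ConnectedComponent

/-- Whenever `G` is in the set and `u`, `v` lie in distinct components of `G`, the graph `G + uv`
is in the set. -/
def BridgeAddable (A : GraphSet) : Prop :=
  ∀ (n : ℕ), ∀ G ∈ A n, ∀ u v : Fin n, ¬ G.Reachable u v → G ⊔ SimpleGraph.edge u v ∈ A n

/-- Bridge-addable and closed under deleting bridges. -/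
def BridgeAlterable (A : GraphSet) : Prop :=
  BridgeAddable A ∧ ∀ (n : ℕ), ∀ G ∈ A n, ∀ e ∈ bridgeSet G, G.deleteEdges {e} ∈ A n

/-- A weighting `(λ, ν, f)`: `λ, ν > 0` and `f(G) ≥ 0` for each bridge-free graph `G`.  The values
of `f` at graphs with bridges play no role. -/
structure Weighting where
  lam : ℝ
  nu : ℝ
  f : {n : ℕ} → SimpleGraph (Fin n) → ℝ
  lam_pos : 0 < lam
  nu_pos : 0 < nu
  f_nonneg : ∀ {n : ℕ} (G : SimpleGraph (Fin n)), bridgeSet G = ∅ → 0 ≤ f G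

/-- The weight `τ(G) = f(G̃) λ^{e₀(G)} ν^{κ(G)}`. -/
noncomputable def Weighting.weight (τ : Weighting) {n : ℕ} (G : SimpleGraph (Fin n)) : ℝ :=
  τ.f (removeBridges G) * τ.lam ^ numBridges G * τ.nu ^ numComponents G

/-- `τ(B) = ∑_{G ∈ B} τ(G)` for a set `B` of graphs on `Fin n`. -/
noncomputable def Weighting.totalWeight (τ : Weighting) {n : ℕ}
    (B : Set (SimpleGraph (Fin n))) : ℝ :=
  ∑ G ∈ (Set.toFinite B).toFinset, τ.weight G

/-- `R` is a random graph sampled from `B` with the weighting `τ`: `τ(B) > 0` and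
`Pr(R = G) = τ(G) / τ(B)` for each `G ∈ B`. -/
structure IsSampledFrom {Ω : Type*} [MeasurableSpace Ω] (P : Measure Ω) (τ : Weighting) {n : ℕ}
    (B : Set (SimpleGraph (Fin n))) (R : Ω → SimpleGraph (Fin n)) : Prop where
  totalWeight_pos : 0 < τ.totalWeight B
  measurable : Measurable R
  prob_eq : ∀ G ∈ B, P {ω | R ω = G} = ENNReal.ofReal (τ.weight G / τ.totalWeight B)

/-- `X_n ≤_s Y` asymptotically: `limsup_n Pr(X_n ≥ t) ≤ Pr(Y ≥ t)` for each fixed `t`. -/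
def AsymptoticallyStochLE {Ω : ℕ → Type*} [∀ n, MeasurableSpace (Ω n)]
    (P : (n : ℕ) → Measure (Ω n)) (X : (n : ℕ) → Ω n → ℕ)
    {Ω' : Type*} [MeasurableSpace Ω'] (Q : Measure Ω') (Y : Ω' → ℕ) : Prop :=
  ∀ t : ℕ, limsup (fun n => P n {ω | t ≤ X n ω}) atTop ≤ Q {ω | t ≤ Y ω}

end BridgeGraph

/-!
A bridge-alterable set is closed under deleting a bridge and under joining two components. These
operations are inverse to each other and keep the bridge-free part of the graph, so joining two
components multiplies the weight `τ` by `λ / ν`. Hence a sum over (graph, bridge) can be rewritten as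
a sum over (graph, pair of vertices in distinct components); this double counting,
`sum_slice_bridgePairs`, is the only structural input.

Let `τ_k` be the total weight of the graphs in `A n` with `k` components. The heart of the matter
is `sum_slice_succ_le`: `2 λ k τ_{k+1} ≤ ν (1 + 5 k / n) τ_k`. A graph with `k + 1` components has
at least `k` pairs of components whose union is strictly larger than all the other components. Pick
vertices `u`, `v` in such a pair, with components of sizes `s`, `t`, and give the choice the weight
`1 / (s t)`. Joining `u` to `v` turns this into a sum of `1 / (s t)` over the bridges of the
strictly largest component of a graph with `k` components. That component has some number `b` of
vertices, and `b² / (s t) = 2 + s / t + t / s`. A component on `t` vertices with `e` bridges has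
`1 ≤ t - e` (`bridgeCount_le`), so that `s / t ≤ s - e s / t`. The first terms add up to `s + t = b`
for each bridge. The second ones range over ordered pairs of bridges; deleting both bridges leaves
three components, and as the three play symmetric roles (`sum_crossTriples_add`) the average of
`s / t` over the ways to reattach them is `1 / 2`. With `e` bridges in the component the total is
thus at most `2 e (2 + b) - e (e - 1) ≤ b² + 5 b` over oriented bridges, half as much over bridges;
this is where the factor `2` in `ν / (2 λ)` comes from.

The probabilities `q_i` of having `i + 1` components therefore satisfy
`(i + 1) q_{i+1} ≤ y (1 + 5 (i + 1) / n) q_i` with `y = ν / (2 λ)`. Comparing ratios bounds their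
tails by those of a sequence that tends to the Poisson weights (`tail_le`, with dominated
convergence in `tendsto_tsum_majorant`), and summing over `i` bounds the mean (`mean_le`).
-/

namespace BridgeGraph

section Combinatorics

open Finset
open scoped Classical

variable {V : Type*} {G F : SimpleGraph V} {u v x y : V}

/-! ### Adding an edge between two components -/

/-- An added edge joins the components of its ends, and changes nothing else. -/
theorem reachable_sup_edge_iff :
    (F ⊔ SimpleGraph.edge u v).Reachable x y ↔
      F.Reachable x y ∨ (F.Reachable x u ∧ F.Reachable v y) ∨
        (F.Reachable x v ∧ F.Reachable u y) := by
  constructor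
  · rintro ⟨p⟩
    induction p with
    | nil => exact .inl .rfl
    | @cons a b c h p ih =>
      rw [SimpleGraph.sup_adj, SimpleGraph.edge_adj] at h
      rcases h with h | ⟨⟨rfl, rfl⟩ | ⟨rfl, rfl⟩, -⟩
      · rcases ih with ih | ⟨h1, h2⟩ | ⟨h1, h2⟩
        · exact .inl (h.reachable.trans ih)
        · exact .inr (.inl ⟨h.reachable.trans h1, h2⟩)
        · exact .inr (.inr ⟨h.reachable.trans h1, h2⟩)
      · rcases ih with ih | ⟨h1, h2⟩ | ⟨h1, h2⟩
        · exact .inr (.inl ⟨.rfl, ih⟩)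
        · exact .inr (.inl ⟨.rfl, h2⟩)
        · exact .inl h2
      · rcases ih with ih | ⟨h1, h2⟩ | ⟨h1, h2⟩
        · exact .inr (.inr ⟨.rfl, ih⟩)
        · exact .inl h2
        · exact .inr (.inr ⟨.rfl, h2⟩)
  · have hle : F ≤ F ⊔ SimpleGraph.edge u v := le_sup_left
    have huv : (F ⊔ SimpleGraph.edge u v).Reachable u v := by
      by_cases h : u = v
      · exact h ▸ .rfl
      · exact SimpleGraph.Adj.reachable (by simp [SimpleGraph.edge_adj, h])
    rintro (h | ⟨h1, h2⟩ | ⟨h1, h2⟩)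
    · exact h.mono hle
    · exact (h1.mono hle).trans (huv.trans (h2.mono hle))
    · exact (h1.mono hle).trans (huv.symm.trans (h2.mono hle))

theorem mem_bridgeSet_mk :
    s(u, v) ∈ bridgeSet G ↔ G.Adj u v ∧ ¬ (G.deleteEdges {s(u, v)}).Reachable u v := by
  simp [bridgeSet, SimpleGraph.isBridge_iff]

theorem sup_edge_deleteEdges_self (h : ¬ F.Reachable u v) :
    (F ⊔ SimpleGraph.edge u v).deleteEdges {s(u, v)} = F := by
  have hn : ¬ F.Adj u v := fun h' => h h'.reachable
  ext a b
  simp only [SimpleGraph.deleteEdges_adj, SimpleGraph.sup_adj, SimpleGraph.edge_adj,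
    Set.mem_singleton_iff, Sym2.eq_iff]
  constructor
  · tauto
  · intro hab
    refine ⟨.inl hab, ?_⟩
    rintro (⟨rfl, rfl⟩ | ⟨rfl, rfl⟩)
    exacts [hn hab, hn hab.symm]

theorem deleteEdges_sup_edge_self (h : G.Adj u v) :
    G.deleteEdges {s(u, v)} ⊔ SimpleGraph.edge u v = G := by
  ext a b
  simp only [SimpleGraph.deleteEdges_adj, SimpleGraph.sup_adj, SimpleGraph.edge_adj,
    Set.mem_singleton_iff, Sym2.eq_iff]
  constructor
  · rintro (h' | ⟨⟨rfl, rfl⟩ | ⟨rfl, rfl⟩, -⟩)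
    exacts [h'.1, h, h.symm]
  · intro hab
    have := hab.ne
    tauto

theorem deleteEdges_sup_edge_comm {e : Sym2 V} (h : e ≠ s(u, v)) :
    (F ⊔ SimpleGraph.edge u v).deleteEdges {e} = F.deleteEdges {e} ⊔ SimpleGraph.edge u v := by
  ext a b
  simp only [SimpleGraph.deleteEdges_adj, SimpleGraph.sup_adj, SimpleGraph.edge_adj,
    Set.mem_singleton_iff]
  constructor
  · tauto
  · rintro (h' | ⟨h1, h2⟩)
    · exact ⟨.inl h'.1, h'.2⟩
    · refine ⟨.inr ⟨h1, h2⟩, ?_⟩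
      rintro rfl
      rcases h1 with ⟨rfl, rfl⟩ | ⟨rfl, rfl⟩
      · exact h rfl
      · exact h Sym2.eq_swap

theorem bridgeSet_sup_edge (h : ¬ F.Reachable u v) :
    bridgeSet (F ⊔ SimpleGraph.edge u v) = insert s(u, v) (bridgeSet F) := by
  have hne : u ≠ v := fun h' => h (h' ▸ .rfl)
  ext e
  induction e with | h a b =>
  rw [Set.mem_insert_iff]
  by_cases he : s(a, b) = s(u, v)
  · simp only [he, true_or, iff_true]
    rw [mem_bridgeSet_mk, sup_edge_deleteEdges_self h]
    exact ⟨by simp [SimpleGraph.edge_adj, hne], h⟩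
  · simp only [he, false_or]
    rw [mem_bridgeSet_mk, mem_bridgeSet_mk, deleteEdges_sup_edge_comm he,
      reachable_sup_edge_iff]
    have hadj : (F ⊔ SimpleGraph.edge u v).Adj a b ↔ F.Adj a b := by
      rw [Sym2.eq_iff] at he
      simp only [SimpleGraph.sup_adj, SimpleGraph.edge_adj]
      tauto
    rw [hadj]
    refine and_congr_right fun hab => not_congr ⟨?_, .inl⟩
    have hle : F.deleteEdges {s(a, b)} ≤ F := SimpleGraph.deleteEdges_le _
    rintro (h' | ⟨h1, h2⟩ | ⟨h1, h2⟩)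
    · exact h'
    · exact absurd ((h1.mono hle).symm.trans (hab.reachable.trans (h2.mono hle).symm)) h
    · exact absurd ((h2.mono hle).trans (hab.reachable.symm.trans (h1.mono hle))) h

theorem removeBridges_sup_edge (h : ¬ F.Reachable u v) :
    removeBridges (F ⊔ SimpleGraph.edge u v) = removeBridges F := by
  have hn : ¬ F.Adj u v := fun h' => h h'.reachable
  unfold removeBridges
  rw [bridgeSet_sup_edge h]
  ext a b
  simp only [SimpleGraph.deleteEdges_adj, SimpleGraph.sup_adj, SimpleGraph.edge_adj,
    Set.mem_insert_iff, Sym2.eq_iff]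
  constructor
  · tauto
  · rintro ⟨hab, h2⟩
    refine ⟨.inl hab, ?_⟩
    rintro ((⟨rfl, rfl⟩ | ⟨rfl, rfl⟩) | h')
    exacts [hn hab, hn hab.symm, h2 h']

variable [Fintype V]

theorem numBridges_sup_edge (h : ¬ F.Reachable u v) :
    numBridges (F ⊔ SimpleGraph.edge u v) = numBridges F + 1 := by
  unfold numBridges
  rw [bridgeSet_sup_edge h, Set.ncard_insert_of_notMem _ (Set.toFinite _)]
  exact fun h' => h (SimpleGraph.Adj.reachable (mem_bridgeSet_mk.1 h').1)

/-- Every graph arises from its bridge-free part by successively joining distinct components by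
new edges; this is the corresponding induction principle. -/
theorem bridge_induction {motive : SimpleGraph V → Prop}
    (base : ∀ G, bridgeSet G = ∅ → motive G)
    (step : ∀ F u v, ¬ F.Reachable u v → motive F → motive (F ⊔ SimpleGraph.edge u v))
    (G : SimpleGraph V) : motive G := by
  induction hk : numBridges G generalizing G with
  | zero =>
    refine base G ?_
    rwa [numBridges, Set.ncard_eq_zero (Set.toFinite _)] at hk
  | succ k ih =>
    have hne : (bridgeSet G).Nonempty := by
      rw [Set.nonempty_iff_ne_empty]
      intro h0
      simp [numBridges, h0] at hk
    obtain ⟨e, he⟩ := hne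
    induction e with | h u v =>
    rw [mem_bridgeSet_mk] at he
    have hG := deleteEdges_sup_edge_self he.1
    rw [← hG]
    refine step _ _ _ he.2 (ih _ ?_)
    have := numBridges_sup_edge he.2
    rw [hG] at this
    omega

theorem bridgeSet_removeBridges (G : SimpleGraph V) : bridgeSet (removeBridges G) = ∅ := by
  induction G using bridge_induction with
  | base G h => simp [removeBridges, h]
  | step F u v h ih => rwa [removeBridges_sup_edge h]

/-! ### Components as finite sets of vertices -/

/-- The vertex set of the component of `u` in `G`. -/
noncomputable def comp (G : SimpleGraph V) (u : V) : Finset V := {x | G.Reachable u x}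

/-- The number of vertices of the component of `u` in `G`, as a real number. -/
noncomputable def compSize (G : SimpleGraph V) (u : V) : ℝ := #(comp G u)

@[simp] theorem mem_comp : x ∈ comp G u ↔ G.Reachable u x := by simp [comp]

theorem self_mem_comp : u ∈ comp G u := by simp

theorem comp_congr (h : G.Reachable u v) : comp G u = comp G v := by
  ext x; simp only [mem_comp]; exact ⟨h.symm.trans, h.trans⟩

theorem compSize_congr (h : G.Reachable u v) : compSize G u = compSize G v := by
  rw [compSize, compSize, comp_congr h]

theorem one_le_compSize : 1 ≤ compSize G u := by
  unfold compSize
  exact_mod_cast Finset.card_pos.2 ⟨u, self_mem_comp⟩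

theorem compSize_pos : 0 < compSize G u := one_pos.trans_le one_le_compSize

theorem disjoint_comp (h : ¬ G.Reachable u v) : Disjoint (comp G u) (comp G v) := by
  rw [Finset.disjoint_left]
  intro x hx hy
  rw [mem_comp] at hx hy
  exact h (hx.trans hy.symm)

theorem card_comp_union (h : ¬ G.Reachable u v) :
    (#(comp G u ∪ comp G v) : ℝ) = compSize G u + compSize G v := by
  rw [card_union_of_disjoint (disjoint_comp h)]; simp [compSize]

theorem comp_sup_edge_left : comp (F ⊔ SimpleGraph.edge u v) u = comp F u ∪ comp F v := by
  ext x
  simp only [mem_comp, reachable_sup_edge_iff, mem_union]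
  constructor
  · rintro (h | ⟨_, h⟩ | ⟨h1, h2⟩) <;> tauto
  · rintro (h | h)
    · exact .inl h
    · exact .inr (.inl ⟨.rfl, h⟩)

theorem compSize_sup_edge_left (h : ¬ F.Reachable u v) :
    compSize (F ⊔ SimpleGraph.edge u v) u = compSize F u + compSize F v := by
  rw [compSize, comp_sup_edge_left, card_comp_union h]

theorem comp_sup_edge_of_not_reachable (hu : ¬ F.Reachable u x) (hv : ¬ F.Reachable v x) :
    comp (F ⊔ SimpleGraph.edge u v) x = comp F x := by
  ext y
  simp only [mem_comp, reachable_sup_edge_iff]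
  have hu' : ¬ F.Reachable x u := fun h => hu h.symm
  have hv' : ¬ F.Reachable x v := fun h => hv h.symm
  tauto

theorem compSize_sup_edge_of_not_reachable (hu : ¬ F.Reachable u x) (hv : ¬ F.Reachable v x) :
    compSize (F ⊔ SimpleGraph.edge u v) x = compSize F x := by
  rw [compSize, comp_sup_edge_of_not_reachable hu hv, compSize]

theorem sum_comp_const {c : ℝ} {g : V → ℝ} (h : ∀ x ∈ comp G u, g x = c) :
    ∑ x ∈ comp G u, g x = compSize G u * c := by
  rw [Finset.sum_congr rfl h, sum_const, nsmul_eq_mul, compSize]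

theorem sum_comp_inv_compSize : ∑ x ∈ comp G u, (compSize G x)⁻¹ = 1 := by
  rw [sum_comp_const (c := (compSize G u)⁻¹)
    (fun x hx => by rw [compSize_congr (mem_comp.1 hx)])]
  exact mul_inv_cancel₀ compSize_pos.ne'

/-- Each component contributes `1` to this sum, which makes `κ` easy to compare between graphs. -/
theorem sum_inv_compSize (G : SimpleGraph V) :
    ∑ x, (compSize G x)⁻¹ = numComponents G := by
  rw [← Finset.sum_fiberwise univ G.connectedComponentMk]
  have h : ∀ c : G.ConnectedComponent,
      ∑ x with G.connectedComponentMk x = c, (compSize G x)⁻¹ = 1 := by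
    intro c
    induction c using SimpleGraph.ConnectedComponent.ind with | h w =>
    rw [← sum_comp_inv_compSize (G := G) (u := w)]
    congr 1
    ext x
    simp [SimpleGraph.ConnectedComponent.eq, SimpleGraph.reachable_comm]
  simp [h, numComponents, Nat.card_eq_fintype_card]

theorem numComponents_sup_edge (h : ¬ F.Reachable u v) :
    numComponents (F ⊔ SimpleGraph.edge u v) + 1 = numComponents F := by
  have h1 := sum_inv_compSize F
  have h2 := sum_inv_compSize (F ⊔ SimpleGraph.edge u v)
  set G := F ⊔ SimpleGraph.edge u v
  have e1 : ∀ H : SimpleGraph V, ∑ x, (compSize H x)⁻¹ =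
      ∑ x ∈ comp F u ∪ comp F v, (compSize H x)⁻¹ +
        ∑ x ∈ (comp F u ∪ comp F v)ᶜ, (compSize H x)⁻¹ := fun H =>
    (sum_add_sum_compl _ _).symm
  rw [e1, sum_union (disjoint_comp h), sum_comp_inv_compSize, sum_comp_inv_compSize] at h1
  rw [e1, ← comp_sup_edge_left, sum_comp_inv_compSize, comp_sup_edge_left] at h2
  have h3 : ∑ x ∈ (comp F u ∪ comp F v)ᶜ, (compSize G x)⁻¹ =
      ∑ x ∈ (comp F u ∪ comp F v)ᶜ, (compSize F x)⁻¹ := by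
    refine sum_congr rfl fun x hx => ?_
    simp only [mem_compl, mem_union, mem_comp, not_or] at hx
    rw [compSize_sup_edge_of_not_reachable hx.1 hx.2]
  have : ((numComponents G + 1 : ℕ) : ℝ) = numComponents F := by
    push_cast; linarith
  exact_mod_cast this

theorem numComponents_le_card (G : SimpleGraph V) : numComponents G ≤ Fintype.card V := by
  rw [numComponents, Nat.card_eq_fintype_card]
  exact Fintype.card_le_of_surjective G.connectedComponentMk Quot.mk_surjective

theorem numComponents_pos [Nonempty V] (G : SimpleGraph V) : 0 < numComponents G := by
  rw [numComponents, Nat.card_eq_fintype_card]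
  exact Fintype.card_pos_iff.2 inferInstance

theorem connected_iff_numComponents {V : Type*} {G : SimpleGraph V} :
    G.Connected ↔ numComponents G = 1 := by
  rw [SimpleGraph.connected_iff_exists_forall_reachable, numComponents, Nat.card_eq_one_iff_exists]
  constructor
  · rintro ⟨w, hw⟩
    refine ⟨G.connectedComponentMk w, fun c => ?_⟩
    induction c using SimpleGraph.ConnectedComponent.ind with | h x =>
    exact SimpleGraph.ConnectedComponent.eq.2 (hw x).symm
  · rintro ⟨c, hc⟩
    induction c using SimpleGraph.ConnectedComponent.ind with | h w =>
    exact ⟨w, fun x => SimpleGraph.ConnectedComponent.eq.1 (hc _).symm⟩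

end Combinatorics

section Counting

open Finset
open scoped Classical

variable {V : Type*} [Fintype V] {G F : SimpleGraph V} {u v x y : V}

/-! ### Bridges and cross pairs, counted with orientation -/

/-- The ordered pairs of vertices in distinct components of `F`. -/
noncomputable def crossPairs (F : SimpleGraph V) : Finset (V × V) :=
  {p | ¬ F.Reachable p.1 p.2}

/-- The bridges of `G`, each in both of its orientations. -/
noncomputable def bridgePairs (G : SimpleGraph V) : Finset (V × V) :=
  {p | s(p.1, p.2) ∈ bridgeSet G}

/-- Twice the number of bridges of `G` in the component of `w`. -/
noncomputable def bridgeCount (G : SimpleGraph V) (w : V) : ℝ :=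
  ∑ p ∈ bridgePairs G, if G.Reachable w p.1 then 1 else 0

@[simp] theorem mem_crossPairs {p : V × V} : p ∈ crossPairs F ↔ ¬ F.Reachable p.1 p.2 := by
  simp [crossPairs]

@[simp] theorem mem_bridgePairs {p : V × V} :
    p ∈ bridgePairs G ↔ s(p.1, p.2) ∈ bridgeSet G := by
  simp [bridgePairs]

theorem bridgeCount_congr (h : G.Reachable u v) : bridgeCount G u = bridgeCount G v := by
  unfold bridgeCount
  refine sum_congr rfl fun p _ => ?_
  have : G.Reachable u p.1 ↔ G.Reachable v p.1 := ⟨h.symm.trans, h.trans⟩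
  simp [this]

theorem sum_bridgePairs_sup_edge (h : ¬ F.Reachable u v) (g : V × V → ℝ) :
    ∑ p ∈ bridgePairs (F ⊔ SimpleGraph.edge u v), g p =
      g (u, v) + g (v, u) + ∑ p ∈ bridgePairs F, g p := by
  have hne : u ≠ v := fun h' => h (h' ▸ .rfl)
  have hn : s(u, v) ∉ bridgeSet F := fun h' => h (mem_bridgeSet_mk.1 h').1.reachable
  have : bridgePairs (F ⊔ SimpleGraph.edge u v) = {(u, v), (v, u)} ∪ bridgePairs F := by
    ext ⟨a, b⟩
    simp [bridgeSet_sup_edge h, Prod.ext_iff, or_assoc]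
  rw [this, sum_union, sum_pair (by simp [hne])]
  rw [Finset.disjoint_left]
  intro p hp
  simp only [mem_insert, mem_singleton] at hp
  rw [mem_bridgePairs]
  rcases hp with rfl | rfl
  · exact hn
  · rwa [Sym2.eq_swap]

theorem bridgeCount_sup_edge (h : ¬ F.Reachable u v) :
    bridgeCount (F ⊔ SimpleGraph.edge u v) u = 2 + bridgeCount F u + bridgeCount F v := by
  have hsum := sum_bridgePairs_sup_edge h
  have hcomp := comp_sup_edge_left (F := F) (u := u) (v := v)
  generalize F ⊔ SimpleGraph.edge u v = G at hsum hcomp ⊢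
  have hsplit : ∀ w, (if G.Reachable u w then (1 : ℝ) else 0) =
      (if F.Reachable u w then 1 else 0) + if F.Reachable v w then 1 else 0 := by
    intro w
    have := mem_comp (G := G) (u := u) (x := w)
    rw [hcomp, mem_union, mem_comp, mem_comp] at this
    have h' : ¬ (F.Reachable u w ∧ F.Reachable v w) := fun h' => h (h'.1.trans h'.2.symm)
    by_cases h1 : F.Reachable u w <;> by_cases h2 : F.Reachable v w <;> simp_all
  rw [bridgeCount, hsum]
  simp only [hsplit, sum_add_distrib]
  have h' : ¬ F.Reachable v u := fun h' => h h'.symm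
  simp only [bridgeCount, SimpleGraph.Reachable.rfl, h, h', if_true, if_false]
  ring

theorem bridgeCount_sup_edge_of_not_reachable (hu : ¬ F.Reachable u x) (hv : ¬ F.Reachable v x)
    (h : ¬ F.Reachable u v) :
    bridgeCount (F ⊔ SimpleGraph.edge u v) x = bridgeCount F x := by
  have hsplit : ∀ w, (F ⊔ SimpleGraph.edge u v).Reachable x w ↔ F.Reachable x w := by
    intro w
    rw [← mem_comp, comp_sup_edge_of_not_reachable hu hv, mem_comp]
  rw [bridgeCount, sum_bridgePairs_sup_edge h]
  have h1 : ¬ F.Reachable x u := fun h' => hu h'.symm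
  have h2 : ¬ F.Reachable x v := fun h' => hv h'.symm
  simp [hsplit, h1, h2, bridgeCount]

/-- The bridges of a component on `s` vertices form a forest, so there are at most `s - 1`. -/
theorem bridgeCount_le (G : SimpleGraph V) (w : V) :
    bridgeCount G w ≤ 2 * (compSize G w - 1) := by
  induction G using bridge_induction generalizing w with
  | base G h =>
    have : bridgePairs G = ∅ := by ext; simp [h]
    have := one_le_compSize (G := G) (u := w)
    simp only [bridgeCount, *, sum_empty]
    linarith
  | step F u v h ih =>
    have key : bridgeCount (F ⊔ SimpleGraph.edge u v) u ≤
        2 * (compSize (F ⊔ SimpleGraph.edge u v) u - 1) := by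
      rw [bridgeCount_sup_edge h, compSize_sup_edge_left h]
      linarith [ih u, ih v]
    by_cases hw : (F ⊔ SimpleGraph.edge u v).Reachable u w
    · rwa [← bridgeCount_congr hw, ← compSize_congr hw]
    · have hu : ¬ F.Reachable u w := fun h' => hw (h'.mono le_sup_left)
      have hv : ¬ F.Reachable v w :=
        fun h' => hw (reachable_sup_edge_iff.2 (.inr (.inl ⟨.rfl, h'⟩)))
      rw [bridgeCount_sup_edge_of_not_reachable hu hv h,
        compSize_sup_edge_of_not_reachable hu hv]
      exact ih w

/-- `|B|⁻²` if the vertex set `B`, a union of components of `F`, is strictly larger than every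
other component of `F`, and `0` otherwise. At most one component of a graph has nonzero value. -/
noncomputable def dominance (F : SimpleGraph V) (B : Finset V) : ℝ :=
  if ∀ x ∉ B, compSize F x < #B then ((#B : ℝ) ^ 2)⁻¹ else 0

theorem dominance_nonneg (F : SimpleGraph V) (B : Finset V) : 0 ≤ dominance F B := by
  unfold dominance; split_ifs <;> positivity

/-- The dominance of the union of the components of `u` and `v`. -/
noncomputable def pairDominance (F : SimpleGraph V) (u v : V) : ℝ :=
  dominance F (comp F u ∪ comp F v)

theorem pairDominance_comm (F : SimpleGraph V) (u v : V) :
    pairDominance F u v = pairDominance F v u := by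
  rw [pairDominance, union_comm, pairDominance]

theorem pairDominance_nonneg (F : SimpleGraph V) (u v : V) : 0 ≤ pairDominance F u v :=
  dominance_nonneg _ _

/-- The dominance of a union of components does not change when edges are added inside it. -/
theorem dominance_sup_edge {B : Finset V} (hu : u ∈ B) (hv : v ∈ B)
    (hB : ∀ x ∈ B, ∀ y, F.Reachable x y → y ∈ B) :
    dominance (F ⊔ SimpleGraph.edge u v) B = dominance F B := by
  have : ∀ x ∉ B, compSize (F ⊔ SimpleGraph.edge u v) x = compSize F x := fun x hx =>
    compSize_sup_edge_of_not_reachable (fun h => hx (hB u hu x h)) (fun h => hx (hB v hv x h))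
  unfold dominance
  congr 1
  exact propext (forall₂_congr fun x hx => by rw [this x hx])

theorem dominance_comp_sup_edge_left :
    dominance (F ⊔ SimpleGraph.edge u v) (comp (F ⊔ SimpleGraph.edge u v) u) =
      pairDominance F u v := by
  rw [pairDominance, comp_sup_edge_left]
  refine dominance_sup_edge (by simp) (by simp) fun x hx y hxy => ?_
  simp only [mem_union, mem_comp] at hx ⊢
  exact hx.imp (·.trans hxy) (·.trans hxy)

theorem sum_crossPairs_swap (F : SimpleGraph V) (g : V × V → ℝ) :
    ∑ p ∈ crossPairs F, g p.swap = ∑ p ∈ crossPairs F, g p := by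
  refine sum_nbij' Prod.swap Prod.swap ?_ ?_ ?_ ?_ ?_ <;>
    simp [SimpleGraph.reachable_comm]

/-- The pairs that join a fixed largest component to another one already contribute
`2 (κ(F) - 1)`. -/
theorem two_mul_numComponents_sub_one_le [Nonempty V] (F : SimpleGraph V) :
    2 * ((numComponents F : ℝ) - 1) ≤
      ∑ p ∈ crossPairs F, pairDominance F p.1 p.2 *
        (compSize F p.1 + compSize F p.2) ^ 2 / (compSize F p.1 * compSize F p.2) := by
  obtain ⟨w, -, hw⟩ := exists_max_image univ (compSize F) univ_nonempty
  have hterm : ∀ a b, F.Reachable w a → ¬ F.Reachable w b →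
      pairDominance F a b * (compSize F a + compSize F b) ^ 2 /
        (compSize F a * compSize F b) = (compSize F a)⁻¹ * (compSize F b)⁻¹ := by
    intro a b ha hb
    have hab : ¬ F.Reachable a b := fun h => hb (ha.trans h)
    have hpa := compSize_pos (G := F) (u := a)
    have hpb := compSize_pos (G := F) (u := b)
    rw [pairDominance, dominance, if_pos, card_comp_union hab]
    · field_simp
    · intro x _
      rw [card_comp_union hab, ← compSize_congr ha]
      linarith [hw x (mem_univ x)]
  set S := comp F w ×ˢ (comp F w)ᶜ
  set S' := (comp F w)ᶜ ×ˢ comp F w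
  have hsum : ∑ p ∈ S, (compSize F p.1)⁻¹ * (compSize F p.2)⁻¹ = numComponents F - 1 := by
    rw [← sum_inv_compSize, ← sum_add_sum_compl (comp F w), sum_comp_inv_compSize, sum_product]
    simp only [← mul_sum, ← sum_mul, sum_comp_inv_compSize]
    ring
  have hsum' : ∑ p ∈ S', (compSize F p.1)⁻¹ * (compSize F p.2)⁻¹ = numComponents F - 1 := by
    rw [← hsum]
    refine sum_nbij' Prod.swap Prod.swap ?_ ?_ ?_ ?_ ?_ <;>
      simp +contextual [S, S', mul_comm]
  have hdisj : Disjoint S S' := by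
    rw [Finset.disjoint_left]
    rintro ⟨a, b⟩
    simp +contextual [S, S']
  have hsub : S ∪ S' ⊆ crossPairs F := by
    rintro ⟨a, b⟩
    simp only [S, S', mem_union, mem_product, mem_compl, mem_comp, mem_crossPairs]
    rintro (⟨h1, h2⟩ | ⟨h1, h2⟩) h
    · exact h2 (h1.trans h)
    · exact h1 (h2.trans h.symm)
  refine le_trans (le_of_eq ?_) (sum_le_sum_of_subset_of_nonneg hsub fun p _ _ => ?_)
  · rw [sum_union hdisj, two_mul]
    congr 1
    · rw [← hsum]
      refine sum_congr rfl fun p hp => ?_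
      simp only [S, mem_product, mem_compl, mem_comp] at hp
      exact (hterm _ _ hp.1 hp.2).symm
    · rw [← hsum']
      refine sum_congr rfl fun p hp => ?_
      simp only [S', mem_product, mem_compl, mem_comp] at hp
      rw [pairDominance_comm, add_comm, mul_comm (compSize F p.1), hterm _ _ hp.2 hp.1, mul_comm]
  · have := pairDominance_nonneg F p.1 p.2
    have := compSize_pos (G := F) (u := p.1)
    have := compSize_pos (G := F) (u := p.2)
    positivity

/-- Since `(s + t)² / (s t) = 2 + s / t + t / s`, the inequality `1 ≤ t - e`, where `e` is the
number of bridges of a component on `t` vertices, bounds `s / t` by `s - e s / t`. -/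
theorem sum_dominance_le (F : SimpleGraph V) :
    ∑ p ∈ crossPairs F, pairDominance F p.1 p.2 *
        (compSize F p.1 + compSize F p.2) ^ 2 / (compSize F p.1 * compSize F p.2) ≤
      ∑ p ∈ crossPairs F, pairDominance F p.1 p.2 *
        (2 + compSize F p.1 + compSize F p.2) -
      ∑ p ∈ crossPairs F, pairDominance F p.1 p.2 *
        (bridgeCount F p.2 * (compSize F p.1 / compSize F p.2)) := by
  set θ : V × V → ℝ := fun p => pairDominance F p.1 p.2
  have hθ : ∀ p, θ p.swap = θ p := fun p => pairDominance_comm F p.2 p.1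
  have hθ0 : ∀ p, 0 ≤ θ p := fun p => pairDominance_nonneg _ _ _
  have e1 : ∑ p ∈ crossPairs F, θ p *
        (compSize F p.1 + compSize F p.2) ^ 2 / (compSize F p.1 * compSize F p.2) =
      ∑ p ∈ crossPairs F, θ p * (1 + compSize F p.1 / compSize F p.2) +
      ∑ p ∈ crossPairs F, θ p.swap * (1 + compSize F p.swap.1 / compSize F p.swap.2) := by
    rw [← sum_add_distrib]
    refine sum_congr rfl fun p _ => ?_
    have := compSize_pos (G := F) (u := p.1)
    have := compSize_pos (G := F) (u := p.2)
    rw [hθ]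
    simp only [Prod.fst_swap, Prod.snd_swap]
    field_simp
    ring
  rw [sum_crossPairs_swap F (fun p => θ p * (1 + compSize F p.1 / compSize F p.2))] at e1
  have e2 : ∑ p ∈ crossPairs F, θ p * (2 + compSize F p.1 + compSize F p.2) =
      ∑ p ∈ crossPairs F, θ p * (1 + compSize F p.1) +
      ∑ p ∈ crossPairs F, θ p.swap * (1 + compSize F p.swap.1) := by
    rw [← sum_add_distrib]
    refine sum_congr rfl fun p _ => ?_
    rw [hθ]
    simp only [Prod.fst_swap]
    ring
  rw [sum_crossPairs_swap F (fun p => θ p * (1 + compSize F p.1))] at e2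
  have e3 : ∑ p ∈ crossPairs F, θ p * (1 + compSize F p.1 / compSize F p.2) ≤
      ∑ p ∈ crossPairs F, θ p * (1 + compSize F p.1) - 2⁻¹ *
      ∑ p ∈ crossPairs F, θ p * (bridgeCount F p.2 * (compSize F p.1 / compSize F p.2)) := by
    rw [mul_sum, ← sum_sub_distrib]
    refine sum_le_sum fun p _ => ?_
    have h1 := compSize_pos (G := F) (u := p.1)
    have h2 := compSize_pos (G := F) (u := p.2)
    have h3 := bridgeCount_le F p.2
    have h4 : compSize F p.1 / compSize F p.2 ≤ compSize F p.1 -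
        2⁻¹ * (bridgeCount F p.2 * (compSize F p.1 / compSize F p.2)) := by
      have : compSize F p.1 = compSize F p.2 * (compSize F p.1 / compSize F p.2) := by
        field_simp
      have h5 : 0 ≤ compSize F p.1 / compSize F p.2 := by positivity
      nlinarith
    nlinarith [mul_le_mul_of_nonneg_left h4 (hθ0 p)]
  rw [e1, e2]
  linarith

end Counting

section Triples

open Finset
open scoped Classical

variable {V : Type*} [Fintype V] {G F : SimpleGraph V} {u v x y : V}

/-! ### Triples of components -/

/-- The ordered triples of vertices in pairwise distinct components of `F`. -/
noncomputable def crossTriples (F : SimpleGraph V) : Finset (V × V × V) :=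
  {t | ¬ F.Reachable t.2.1 t.2.2 ∧ ¬ F.Reachable t.1 t.2.1 ∧ ¬ F.Reachable t.1 t.2.2}

/-- The sum over all `(a, b, c)` in pairwise distinct components of `F` of the size of the
component of `a` times the dominance of the union of the three components. -/
noncomputable def tripleWeight (F : SimpleGraph V) : ℝ :=
  ∑ t ∈ crossTriples F, dominance F (comp F t.1 ∪ (comp F t.2.1 ∪ comp F t.2.2)) * compSize F t.1

/-- The dominance weight does not depend on the order of the triple, so each of its three entries
may serve as the one whose component size is counted. -/
theorem sum_crossTriples_add (F : SimpleGraph V) :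
    ∑ t ∈ crossTriples F, dominance F (comp F t.1 ∪ (comp F t.2.1 ∪ comp F t.2.2)) *
      (compSize F t.2.1 + compSize F t.2.2) = 2 * tripleWeight F := by
  simp only [mul_add, sum_add_distrib, two_mul, tripleWeight]
  congr 1
  · refine sum_nbij' (fun t => (t.2.1, t.1, t.2.2)) (fun t => (t.2.1, t.1, t.2.2))
      ?_ ?_ ?_ ?_ ?_
    · simp +contextual [crossTriples, SimpleGraph.reachable_comm]
    · simp +contextual [crossTriples, SimpleGraph.reachable_comm]
    · simp
    · simp
    · intro t _
      rw [union_left_comm]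
  · refine sum_nbij' (fun t => (t.2.2, t.2.1, t.1)) (fun t => (t.2.2, t.2.1, t.1))
      ?_ ?_ ?_ ?_ ?_
    · simp +contextual [crossTriples, SimpleGraph.reachable_comm]
    · simp +contextual [crossTriples, SimpleGraph.reachable_comm]
    · simp
    · simp
    · intro t _
      dsimp only
      congr 2
      ext; simp only [mem_union]; tauto

theorem sum_crossPairs_eq_sum_crossTriples (F : SimpleGraph V) (f : V → V → V → ℝ) :
    ∑ q ∈ crossPairs F, ∑ a, (if ¬ F.Reachable a q.1 ∧ ¬ F.Reachable a q.2 then f a q.1 q.2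
      else 0) = ∑ t ∈ crossTriples F, f t.1 t.2.1 t.2.2 := by
  rw [crossTriples, crossPairs, sum_filter, sum_filter]
  refine Eq.trans ?_ (Fintype.sum_prod_type_right _).symm
  refine sum_congr rfl fun q _ => ?_
  split_ifs with h <;> simp [h]

/-- The sum of `g a b` times the dominance of the components of `a` and `b`, over the choices of a
vertex `a` outside the component of `b` and a vertex of the component of `b` to join it to. -/
noncomputable def attachedSum (G : SimpleGraph V) (g : V → V → ℝ) (b : V) : ℝ :=
  ∑ p ∈ crossPairs G, if G.Reachable p.2 b then pairDominance G p.1 p.2 * g p.1 b else 0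

/-- If `G` arises from `F` by joining the components of `b` and `c`, then the cross pairs of `G`
whose second entry lies in the merged component correspond to the choice of a third component of
`F` and of one of the vertices of the merged component. -/
theorem attachedSum_sup_edge {b c : V} (hG : G = F ⊔ SimpleGraph.edge b c)
    (h : ¬ F.Reachable b c) (g : V → V → ℝ) :
    attachedSum G g b =
      ∑ a, if ¬ F.Reachable a b ∧ ¬ F.Reachable a c then
        dominance F (comp F a ∪ (comp F b ∪ comp F c)) *
          ((compSize F b + compSize F c) * g a b) else 0 := by
  have hcomp : comp G b = comp F b ∪ comp F c := hG ▸ comp_sup_edge_left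
  unfold attachedSum pairDominance
  rw [crossPairs, sum_filter, Fintype.sum_prod_type]
  refine sum_congr rfl fun a _ => ?_
  have hab : G.Reachable a b ↔ F.Reachable a b ∨ F.Reachable a c := by
    rw [SimpleGraph.reachable_comm, ← mem_comp, hcomp, mem_union, mem_comp, mem_comp,
      SimpleGraph.reachable_comm, SimpleGraph.reachable_comm (u := c)]
  by_cases ha : G.Reachable a b
  · rw [if_neg (by tauto)]
    refine sum_eq_zero fun w _ => ?_
    split_ifs with h1 h2
    · rfl
    · exact absurd (ha.trans h2.symm) h1
    · rfl
  · rw [if_pos (by tauto)]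
    rw [hab, not_or] at ha
    have hca : comp G a = comp F a := by
      rw [hG, comp_sup_edge_of_not_reachable (fun h => ha.1 h.symm) (fun h => ha.2 h.symm)]
    have hdom : dominance G (comp F a ∪ (comp F b ∪ comp F c)) =
        dominance F (comp F a ∪ (comp F b ∪ comp F c)) := by
      rw [hG]
      refine dominance_sup_edge (by simp) (by simp) fun x hx y hxy => ?_
      simp only [mem_union, mem_comp] at hx ⊢
      exact hx.imp (·.trans hxy) (Or.imp (·.trans hxy) (·.trans hxy))
    have hterm : ∀ w, (if ¬ G.Reachable a w then if G.Reachable w b then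
        dominance G (comp G a ∪ comp G w) * g a b else 0 else 0) =
        if w ∈ comp G b then dominance G (comp G a ∪ comp G b) * g a b else 0 := by
      intro w
      simp only [mem_comp]
      by_cases hw : G.Reachable w b
      · have h1 : ¬ G.Reachable a w := fun h' => by
          have := hab.1 (h'.trans hw); tauto
        rw [if_pos h1, if_pos hw, if_pos hw.symm, comp_congr hw]
      · have h2 : ¬ G.Reachable b w := fun h' => hw h'.symm
        simp [hw, h2]
    simp only [hterm]
    rw [sum_ite_mem, univ_inter, sum_const, nsmul_eq_mul, hca, hcomp, card_comp_union h, hdom]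
    ring

/-- Counting the bridges in the component of `p.2` amounts to choosing an oriented bridge first and
then attaching another component to the one that contains it. -/
theorem sum_mul_bridgeCount (F : SimpleGraph V) {g : V → V → ℝ}
    (hg : ∀ a b c, F.Reachable b c → g a b = g a c) :
    ∑ p ∈ crossPairs F, pairDominance F p.1 p.2 *
      (bridgeCount F p.2 * g p.1 p.2) =
    ∑ q ∈ bridgePairs F, attachedSum F g q.1 := by
  unfold attachedSum
  rw [sum_comm]
  refine sum_congr rfl fun p _ => ?_
  rw [bridgeCount, sum_mul, mul_sum]
  refine sum_congr rfl fun q _ => ?_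
  split_ifs with h
  · rw [hg _ _ _ h, one_mul]
  · ring

/-- Here the value attached to a choice is the ratio of the sizes of the two joined components. -/
theorem sum_attachedSum_ratio (F : SimpleGraph V) :
    ∑ q ∈ crossPairs F, attachedSum (F ⊔ SimpleGraph.edge q.1 q.2)
      (fun a b => compSize (F ⊔ SimpleGraph.edge q.1 q.2) a /
        compSize (F ⊔ SimpleGraph.edge q.1 q.2) b) q.1 = tripleWeight F := by
  rw [tripleWeight, ← sum_crossPairs_eq_sum_crossTriples F (fun a b c =>
    dominance F (comp F a ∪ (comp F b ∪ comp F c)) * compSize F a)]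
  refine sum_congr rfl fun q hq => ?_
  rw [mem_crossPairs] at hq
  rw [attachedSum_sup_edge rfl hq]
  refine sum_congr rfl fun a _ => ?_
  split_ifs with h
  · have := compSize_pos (G := F) (u := q.1)
    have := compSize_pos (G := F) (u := q.2)
    rw [compSize_sup_edge_left hq, compSize_sup_edge_of_not_reachable (fun h' => h.1 h'.symm)
      (fun h' => h.2 h'.symm)]
    field_simp
  · rfl

/-- Without a value attached, the sum is twice as large: the ratio of the sizes averages `1 / 2`. -/
theorem sum_attachedSum_one (F : SimpleGraph V) :
    ∑ q ∈ crossPairs F, attachedSum (F ⊔ SimpleGraph.edge q.1 q.2) (fun _ _ => 1) q.1 =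
      2 * tripleWeight F := by
  rw [← sum_crossTriples_add, ← sum_crossPairs_eq_sum_crossTriples F (fun a b c =>
    dominance F (comp F a ∪ (comp F b ∪ comp F c)) * (compSize F b + compSize F c))]
  refine sum_congr rfl fun q hq => ?_
  rw [mem_crossPairs] at hq
  rw [attachedSum_sup_edge rfl hq]
  simp

/-- When `p.1` and `p.2` are joined, the bridges of the merged component other than the new one
are those of the two joined components, which by symmetry contribute equally. -/
theorem sum_bridgeCount_sup_edge (F : SimpleGraph V) :
    ∑ p ∈ crossPairs F,
      dominance (F ⊔ SimpleGraph.edge p.1 p.2) (comp (F ⊔ SimpleGraph.edge p.1 p.2) p.1) *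
        (bridgeCount (F ⊔ SimpleGraph.edge p.1 p.2) p.1 - 2) =
    2 * ∑ p ∈ crossPairs F, pairDominance F p.1 p.2 *
      (bridgeCount F p.2 * 1) := by
  rw [two_mul]
  conv_rhs => arg 1; rw [← sum_crossPairs_swap]
  rw [← sum_add_distrib]
  refine sum_congr rfl fun p hp => ?_
  rw [mem_crossPairs] at hp
  rw [dominance_comp_sup_edge_left, bridgeCount_sup_edge hp]
  simp only [Prod.fst_swap, Prod.snd_swap]
  rw [pairDominance_comm F p.2]
  ring

/-- The contribution of the strictly largest component, if there is one: with `b` vertices and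
`e` bridges it is `(2 e (2 + b) - e (e - 1)) / b²`, at most `1 + 5 / b` as `e ≤ b`, and `b` is at
least the mean component size. -/
theorem sum_bridgePairs_dominance_le (hn : 0 < Fintype.card V) (G : SimpleGraph V) :
    ∑ p ∈ bridgePairs G, dominance G (comp G p.1) *
      (2 + compSize G p.1 - (bridgeCount G p.1 - 2) / 4) ≤
    1 + 5 * numComponents G / Fintype.card V := by
  have hn' : (0 : ℝ) < Fintype.card V := by exact_mod_cast hn
  by_cases hw : ∃ w, ∀ x ∉ comp G w, compSize G x < compSize G w
  · obtain ⟨w, hw⟩ := hw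
    set b := compSize G w
    have hb : 0 < b := compSize_pos
    have hterm : ∀ p ∈ bridgePairs G, dominance G (comp G p.1) *
        (2 + compSize G p.1 - (bridgeCount G p.1 - 2) / 4) =
        (if G.Reachable w p.1 then 1 else 0) *
          ((b ^ 2)⁻¹ * (2 + b - (bridgeCount G w - 2) / 4)) := by
      intro p _
      split_ifs with h
      · rw [← comp_congr h, ← compSize_congr h, ← bridgeCount_congr h, dominance,
          if_pos (show ∀ x ∉ comp G w, compSize G x < #(comp G w) from hw), one_mul]
        rfl
      · rw [dominance, if_neg]
        · simp
        · intro h'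
          have h1 := hw p.1 (by rwa [mem_comp])
          have h2 := h' w (by rw [mem_comp]; exact fun h' => h h'.symm)
          exact lt_asymm h1 h2
    rw [sum_congr rfl hterm, ← sum_mul]
    change bridgeCount G w * _ ≤ _
    have hd := bridgeCount_le G w
    have hmean : (Fintype.card V : ℝ) ≤ b * numComponents G := by
      -- `|V| = ∑ₓ 1 ≤ ∑ₓ b / s(x) = b κ(G)`
      rw [← sum_inv_compSize, mul_sum, ← card_univ, card_eq_sum_ones, Nat.cast_sum]
      refine sum_le_sum fun x _ => ?_
      have hx : compSize G x ≤ b := by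
        by_cases hx : x ∈ comp G w
        · exact (compSize_congr (mem_comp.1 hx)).ge
        · exact (hw x hx).le
      have hx0 := compSize_pos (G := G) (u := x)
      rw [Nat.cast_one, ← div_eq_mul_inv, one_le_div hx0]
      exact hx
    calc bridgeCount G w * ((b ^ 2)⁻¹ * (2 + b - (bridgeCount G w - 2) / 4))
        = bridgeCount G w * (2 + b - (bridgeCount G w - 2) / 4) / b ^ 2 := by
          field_simp
      _ ≤ (b ^ 2 + 5 * b) / b ^ 2 := by
          gcongr
          nlinarith [sq_nonneg (bridgeCount G w - 2 * b)]
      _ = 1 + 5 / b := by field_simp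
      _ ≤ _ := by
          gcongr 1 + ?_
          rw [div_le_div_iff₀ hb hn']
          linarith
  · rw [sum_eq_zero]
    · positivity
    · intro p _
      rw [dominance, if_neg, zero_mul]
      exact fun h => hw ⟨p.1, h⟩

end Triples

section Weights

open Finset
open scoped Classical

variable {n : ℕ} (τ : Weighting)

/-! ### Weights and double counting -/

theorem Weighting.weight_nonneg (G : SimpleGraph (Fin n)) : 0 ≤ τ.weight G := by
  have := τ.f_nonneg _ (bridgeSet_removeBridges G)
  have := τ.lam_pos
  have := τ.nu_pos
  unfold Weighting.weight
  positivity

theorem Weighting.nu_mul_weight_sup_edge {F : SimpleGraph (Fin n)} {u v : Fin n}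
    (h : ¬ F.Reachable u v) :
    τ.nu * τ.weight (F ⊔ SimpleGraph.edge u v) = τ.lam * τ.weight F := by
  simp only [Weighting.weight, removeBridges_sup_edge h, numBridges_sup_edge h,
    ← numComponents_sup_edge h, pow_succ]
  ring

/-- The members of `B` with exactly `k` components. -/
noncomputable def slice (B : Set (SimpleGraph (Fin n))) (k : ℕ) :
    Finset (SimpleGraph (Fin n)) :=
  {G ∈ (Set.toFinite B).toFinset | numComponents G = k}

@[simp] theorem mem_slice {B : Set (SimpleGraph (Fin n))} {k : ℕ} {G : SimpleGraph (Fin n)} :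
    G ∈ slice B k ↔ G ∈ B ∧ numComponents G = k := by
  simp [slice]

/-- Deleting a bridge and joining two components are inverse to each other, and change the weight
by the factor `λ / ν`. -/
theorem sum_slice_bridgePairs {A : GraphSet} (hA : BridgeAlterable A) (k : ℕ)
    (φ : SimpleGraph (Fin n) → Fin n × Fin n → ℝ) :
    τ.nu * ∑ G ∈ slice (A n) k, τ.weight G * ∑ p ∈ bridgePairs G, φ G p =
      τ.lam * ∑ F ∈ slice (A n) (k + 1), τ.weight F *
        ∑ p ∈ crossPairs F, φ (F ⊔ SimpleGraph.edge p.1 p.2) p := by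
  simp only [mul_sum]
  rw [sum_sigma', sum_sigma']
  refine sum_bij' (fun x _ => ⟨x.1.deleteEdges {s(x.2.1, x.2.2)}, x.2⟩)
    (fun x _ => ⟨x.1 ⊔ SimpleGraph.edge x.2.1 x.2.2, x.2⟩) ?_ ?_ ?_ ?_ ?_
  · rintro ⟨G, u, v⟩ h
    simp only [mem_sigma, mem_slice, mem_bridgePairs, mem_crossPairs] at h ⊢
    have hb := mem_bridgeSet_mk.1 h.2
    refine ⟨⟨hA.2 n G h.1.1 _ h.2, ?_⟩, hb.2⟩
    rw [← numComponents_sup_edge hb.2, deleteEdges_sup_edge_self hb.1, h.1.2]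
  · rintro ⟨F, u, v⟩ h
    simp only [mem_sigma, mem_slice, mem_bridgePairs, mem_crossPairs] at h ⊢
    refine ⟨⟨hA.1 n F h.1.1 _ _ h.2, ?_⟩, ?_⟩
    · have := numComponents_sup_edge h.2
      omega
    · rw [bridgeSet_sup_edge h.2]
      exact Set.mem_insert _ _
  · rintro ⟨G, u, v⟩ h
    simp only [mem_sigma, mem_bridgePairs] at h
    simp only [deleteEdges_sup_edge_self (mem_bridgeSet_mk.1 h.2).1]
  · rintro ⟨F, u, v⟩ h
    simp only [mem_sigma, mem_crossPairs] at h
    simp only [sup_edge_deleteEdges_self h.2]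
  · rintro ⟨G, u, v⟩ h
    simp only [mem_sigma, mem_bridgePairs] at h
    have hb := mem_bridgeSet_mk.1 h.2
    have := τ.nu_mul_weight_sup_edge hb.2
    simp only [deleteEdges_sup_edge_self hb.1] at this ⊢
    rw [← mul_assoc, this, mul_assoc]

/-- With `τ_k` the total weight of the graphs with `k` components,
`2 λ k τ_{k+1} ≤ ν (1 + 5 k / n) τ_k`. -/
theorem sum_slice_succ_le {A : GraphSet} (hA : BridgeAlterable A) (hn : 0 < n) (k : ℕ) :
    2 * τ.lam * k * ∑ F ∈ slice (A n) (k + 1), τ.weight F ≤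
      τ.nu * (1 + 5 * k / n) * ∑ G ∈ slice (A n) k, τ.weight G := by
  have : Nonempty (Fin n) := ⟨⟨0, hn⟩⟩
  have hlam := τ.lam_pos
  have hnu := τ.nu_pos
  set Z := ∑ F ∈ slice (A n) (k + 1 + 1), τ.weight F * tripleWeight F with hZ
  set S₁ := ∑ F ∈ slice (A n) (k + 1), τ.weight F * ∑ p ∈ crossPairs F,
    pairDominance F p.1 p.2 *
      (bridgeCount F p.2 * (compSize F p.1 / compSize F p.2)) with hS₁
  set S₂ := ∑ F ∈ slice (A n) (k + 1), τ.weight F * ∑ p ∈ crossPairs F,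
    pairDominance F p.1 p.2 * (bridgeCount F p.2 * 1) with hS₂
  set S₃ := ∑ G ∈ slice (A n) k, τ.weight G * ∑ p ∈ bridgePairs G,
    dominance G (comp G p.1) * (bridgeCount G p.1 - 2) with hS₃
  set U := ∑ F ∈ slice (A n) (k + 1), τ.weight F * ∑ p ∈ crossPairs F,
    pairDominance F p.1 p.2 * (2 + compSize F p.1 + compSize F p.2) with hU
  set U' := ∑ G ∈ slice (A n) k, τ.weight G * ∑ p ∈ bridgePairs G,
    dominance G (comp G p.1) * (2 + compSize G p.1) with hU'
  have h1 : 2 * k * ∑ F ∈ slice (A n) (k + 1), τ.weight F ≤ U - S₁ := by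
    rw [hU, hS₁, ← sum_sub_distrib, mul_sum]
    refine sum_le_sum fun F hF => ?_
    have hk : (numComponents F : ℝ) = k + 1 := by
      rw [(mem_slice.1 hF).2]; push_cast; ring
    have h2 := (two_mul_numComponents_sub_one_le F).trans (sum_dominance_le F)
    rw [hk, add_sub_cancel_right] at h2
    rw [← mul_sub, mul_comm]
    exact mul_le_mul_of_nonneg_left h2 (τ.weight_nonneg F)
  have hUU : τ.nu * U' = τ.lam * U := by
    rw [hU', sum_slice_bridgePairs τ hA k fun G p =>
      dominance G (comp G p.1) * (2 + compSize G p.1), hU]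
    congr 1
    refine sum_congr rfl fun F _ => ?_
    congr 1
    refine sum_congr rfl fun p hp => ?_
    rw [mem_crossPairs] at hp
    rw [dominance_comp_sup_edge_left, compSize_sup_edge_left hp, add_assoc]
  -- `S₁` and `S₃` both reduce to `Z` by deleting a bridge once more; `S₃` needs two steps, through
  -- `S₂`.
  have hS₁Z : τ.nu * S₁ = τ.lam * Z := by
    have e : S₁ = ∑ F ∈ slice (A n) (k + 1), τ.weight F * ∑ q ∈ bridgePairs F,
        attachedSum F (fun a b => compSize F a / compSize F b) q.1 :=
      sum_congr rfl fun F _ => by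
        rw [← sum_mul_bridgeCount F fun a b c h => by rw [compSize_congr h]]
    rw [e, sum_slice_bridgePairs τ hA (k + 1) fun F q =>
      attachedSum F (fun a b => compSize F a / compSize F b) q.1]
    simp only [sum_attachedSum_ratio, hZ]
  have hS₂Z : τ.nu * S₂ = τ.lam * (2 * Z) := by
    have e : S₂ = ∑ F ∈ slice (A n) (k + 1), τ.weight F * ∑ q ∈ bridgePairs F,
        attachedSum F (fun _ _ => 1) q.1 :=
      sum_congr rfl fun F _ => by rw [← sum_mul_bridgeCount F fun _ _ _ _ => rfl]
    rw [e, sum_slice_bridgePairs τ hA (k + 1) fun F q => attachedSum F (fun _ _ => 1) q.1]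
    simp only [sum_attachedSum_one, hZ, mul_left_comm _ (2 : ℝ), ← mul_sum]
  have hS₃S₂ : τ.nu * S₃ = τ.lam * (2 * S₂) := by
    rw [hS₃, sum_slice_bridgePairs τ hA k fun G p =>
      dominance G (comp G p.1) * (bridgeCount G p.1 - 2)]
    simp only [sum_bridgeCount_sup_edge, hS₂, mul_left_comm _ (2 : ℝ), ← mul_sum]
  have hS₃S₁ : τ.nu * S₃ = 4 * (τ.lam * S₁) := by
    refine mul_left_cancel₀ hnu.ne' ?_
    linear_combination τ.nu * hS₃S₂ + 2 * τ.lam * hS₂Z - 4 * τ.lam * hS₁Z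
  have h2 : U' - S₃ / 4 ≤ (1 + 5 * k / n) * ∑ G ∈ slice (A n) k, τ.weight G := by
    rw [hU', hS₃, sum_div, ← sum_sub_distrib, mul_sum]
    refine sum_le_sum fun G hG => ?_
    have h3 := sum_bridgePairs_dominance_le (by simpa using hn) G
    rw [(mem_slice.1 hG).2, Fintype.card_fin] at h3
    have e : τ.weight G * ∑ p ∈ bridgePairs G, dominance G (comp G p.1) * (2 + compSize G p.1) -
        (τ.weight G * ∑ p ∈ bridgePairs G,
          dominance G (comp G p.1) * (bridgeCount G p.1 - 2)) / 4 =
        τ.weight G * ∑ p ∈ bridgePairs G, dominance G (comp G p.1) *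
          (2 + compSize G p.1 - (bridgeCount G p.1 - 2) / 4) := by
      rw [mul_div_assoc, ← mul_sub, sum_div, ← sum_sub_distrib]
      congr 1
      exact sum_congr rfl fun p _ => by ring
    rw [e, mul_comm (1 + _)]
    exact mul_le_mul_of_nonneg_left h3 (τ.weight_nonneg G)
  calc 2 * τ.lam * k * ∑ F ∈ slice (A n) (k + 1), τ.weight F
      = τ.lam * (2 * k * ∑ F ∈ slice (A n) (k + 1), τ.weight F) := by ring
    _ ≤ τ.lam * (U - S₁) := mul_le_mul_of_nonneg_left h1 hlam.le
    _ = τ.nu * (U' - S₃ / 4) := by linear_combination -hUU + hS₃S₁ / 4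
    _ ≤ τ.nu * ((1 + 5 * k / n) * ∑ G ∈ slice (A n) k, τ.weight G) :=
        mul_le_mul_of_nonneg_left h2 hnu.le
    _ = _ := by ring

end Weights

section Majorant

open Finset Topology

/-! ### Comparison with a perturbed Poisson sequence -/

/-- `1, y (1 + ε₀) / 1, y² (1 + ε₀) (1 + ε₁) / (1 · 2), …` with `ε_l = 5 min ((l + 1) / n, 1)`. For
`n → ∞` it tends to the unnormalised Poisson weights `yⁱ / i!`; the cap at `1` is there to keep it
below `(6 y)ⁱ / i!`. -/
noncomputable def majorant (y : ℝ) (n i : ℕ) : ℝ :=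
  ∏ l ∈ range i, y * (1 + 5 * min (((l : ℝ) + 1) / n) 1) / (l + 1)

variable {y : ℝ}

theorem prod_range_div_succ (c : ℝ) (i : ℕ) :
    ∏ l ∈ range i, c / ((l : ℝ) + 1) = c ^ i / i.factorial := by
  induction i with
  | zero => simp
  | succ i ih =>
    rw [prod_range_succ, ih, Nat.factorial_succ]
    push_cast
    field_simp
    rw [pow_succ]

theorem majorant_succ (n i : ℕ) : majorant y n (i + 1) =
    majorant y n i * (y * (1 + 5 * min (((i : ℝ) + 1) / n) 1) / (i + 1)) :=
  prod_range_succ _ _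

theorem majorant_nonneg (hy : 0 < y) (n i : ℕ) : 0 ≤ majorant y n i := by
  refine prod_nonneg fun l _ => ?_
  have : 0 ≤ min (((l : ℝ) + 1) / n) 1 := by positivity
  positivity

theorem majorant_le (hy : 0 < y) (n i : ℕ) : majorant y n i ≤ (6 * y) ^ i / i.factorial := by
  rw [← prod_range_div_succ]
  refine prod_le_prod (fun l _ => ?_) fun l _ => ?_
  · have : 0 ≤ min (((l : ℝ) + 1) / n) 1 := by positivity
    positivity
  · have : min (((l : ℝ) + 1) / n) 1 ≤ 1 := min_le_right _ _
    rw [mul_comm 6 y]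
    gcongr
    linarith

theorem summable_majorant (hy : 0 < y) (n : ℕ) : Summable (majorant y n) :=
  .of_nonneg_of_le (majorant_nonneg hy n) (majorant_le hy n)
    (Real.summable_pow_div_factorial (6 * y))

theorem tendsto_majorant (y : ℝ) (i : ℕ) :
    Tendsto (fun n => majorant y n i) atTop (𝓝 (y ^ i / i.factorial)) := by
  rw [← prod_range_div_succ]
  refine tendsto_finsetProd _ fun l _ => ?_
  have h1 : Tendsto (fun n : ℕ => ((l : ℝ) + 1) / n) atTop (𝓝 0) :=
    tendsto_const_div_atTop_nhds_zero_nat _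
  have h2 := (((h1.min (tendsto_const_nhds (x := (1 : ℝ)))).const_mul 5).const_add 1).const_mul y
  simpa using h2.div_const ((l : ℝ) + 1)

theorem hasSum_pow_div_factorial (y : ℝ) : HasSum (fun i => y ^ i / i.factorial) (Real.exp y) := by
  rw [Real.exp_eq_exp_ℝ]
  exact NormedSpace.expSeries_div_hasSum_exp y

theorem tendsto_tsum_majorant (hy : 0 < y) :
    Tendsto (fun n => ∑' i, majorant y n i) atTop (𝓝 (Real.exp y)) := by
  rw [← (hasSum_pow_div_factorial y).tsum_eq]
  refine tendsto_tsum_of_dominated_convergence (Real.summable_pow_div_factorial (6 * y))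
    (tendsto_majorant y) (.of_forall fun n i => ?_)
  rw [Real.norm_of_nonneg (majorant_nonneg hy n i)]
  exact majorant_le hy n i

theorem tendsto_one_sub_majorant_ratio (hy : 0 < y) (r : ℕ) :
    Tendsto (fun n => 1 - (∑ i ∈ range r, majorant y n i) / ∑' i, majorant y n i) atTop
      (𝓝 (1 - ∑ i ∈ range r, Real.exp (-y) * y ^ i / i.factorial)) := by
  have h := ((tendsto_finsetSum (range r) fun i _ => tendsto_majorant y i).div
    (tendsto_tsum_majorant hy) (Real.exp_pos y).ne').const_sub 1
  convert! h using 3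
  rw [sum_div]
  refine sum_congr rfl fun i _ => ?_
  rw [Real.exp_neg]
  field_simp

variable {n : ℕ} {q : ℕ → ℝ}

/-- The ratio of `q` to the majorant is nonincreasing. -/
theorem mul_majorant_le (hy : 0 < y)
    (hr : ∀ i, q (i + 1) ≤ q i * (y * (1 + 5 * min (((i : ℝ) + 1) / n) 1) / (i + 1)))
    {k i : ℕ} (hki : k ≤ i) : q i * majorant y n k ≤ q k * majorant y n i := by
  induction i, hki using Nat.le_induction with
  | base => rfl
  | succ i hi ih =>
    rw [majorant_succ]
    have h0 : 0 ≤ y * (1 + 5 * min (((i : ℝ) + 1) / n) 1) / (i + 1) := by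
      have : 0 ≤ min (((i : ℝ) + 1) / n) 1 := by positivity
      positivity
    calc q (i + 1) * majorant y n k
        ≤ q i * (y * (1 + 5 * min (((i : ℝ) + 1) / n) 1) / (i + 1)) * majorant y n k :=
          mul_le_mul_of_nonneg_right (hr i) (majorant_nonneg hy n k)
      _ = q i * majorant y n k * (y * (1 + 5 * min (((i : ℝ) + 1) / n) 1) / (i + 1)) := by ring
      _ ≤ q k * majorant y n i * (y * (1 + 5 * min (((i : ℝ) + 1) / n) 1) / (i + 1)) :=
          mul_le_mul_of_nonneg_right ih h0
      _ = _ := by ring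

/-- A probability sequence whose successive ratios are at most those of the majorant has smaller
tails than the normalised majorant. -/
theorem tail_le (hy : 0 < y) (hq : ∀ i, 0 ≤ q i)
    (hr : ∀ i, q (i + 1) ≤ q i * (y * (1 + 5 * min (((i : ℝ) + 1) / n) 1) / (i + 1)))
    (hsum : ∑ i ∈ range n, q i = 1) {r : ℕ} (hrn : r ≤ n) :
    ∑ i ∈ Ico r n, q i ≤ 1 - (∑ i ∈ range r, majorant y n i) / ∑' i, majorant y n i := by
  have hsm := summable_majorant hy n
  have hS : 0 < ∑' i, majorant y n i :=
    hsm.tsum_pos (majorant_nonneg hy n) 0 (by simp [majorant])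
  have h1 : ∑ i ∈ range r, q i = 1 - ∑ i ∈ Ico r n, q i := by
    rw [← hsum, ← sum_range_add_sum_Ico _ hrn]; ring
  have h2 : ∑ i ∈ Ico r n, majorant y n i ≤
      ∑' i, majorant y n i - ∑ i ∈ range r, majorant y n i := by
    rw [le_sub_iff_add_le', sum_range_add_sum_Ico _ hrn]
    exact hsm.sum_le_tsum _ fun i _ => majorant_nonneg hy n i
  have h3 : (∑ i ∈ Ico r n, q i) * ∑ k ∈ range r, majorant y n k ≤
      (∑ k ∈ range r, q k) * ∑ i ∈ Ico r n, majorant y n i := by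
    rw [sum_mul_sum, sum_mul_sum, sum_comm]
    refine sum_le_sum fun k hk => sum_le_sum fun i hi => ?_
    rw [mem_range] at hk
    rw [mem_Ico] at hi
    exact mul_majorant_le hy hr (by omega)
  have h4 : 0 ≤ ∑ k ∈ range r, q k := sum_nonneg fun i _ => hq i
  -- with `Q` the tail, `S` the total and `S_r` the partial sum of the majorant, this reads
  -- `Q S_r ≤ (1 - Q) (S - S_r)`, that is, `Q S ≤ S - S_r`
  have h5 := h3.trans (mul_le_mul_of_nonneg_left h2 h4)
  rw [h1] at h5
  rw [le_sub_iff_add_le, ← le_sub_iff_add_le', div_le_iff₀ hS]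
  linarith

/-- With `E` the mean of `i + 1`, summing the ratio bounds gives `E - 1 ≤ y + (5 y / n) E`. -/
theorem mean_le (hn : 0 < n) (hy : 0 < y) (hq : ∀ i, 0 ≤ q i)
    (hr : ∀ i, q (i + 1) ≤ q i * (y * (1 + 5 * min (((i : ℝ) + 1) / n) 1) / (i + 1)))
    (hsum : ∑ i ∈ range n, q i = 1) :
    (∑ i ∈ range n, ((i : ℝ) + 1) * q i) * (1 - 5 * y / n) ≤ 1 + y := by
  have hn' : (0 : ℝ) < n := by exact_mod_cast hn
  have h1 : ∑ i ∈ range n, (i : ℝ) * q i ≤ ∑ i ∈ range n, ((i : ℝ) + 1) * q (i + 1) := by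
    have h2 : ∑ i ∈ range n, (i : ℝ) * q i ≤ ∑ i ∈ range (n + 1), (i : ℝ) * q i := by
      rw [sum_range_succ]
      have := hq n
      have : 0 ≤ (n : ℝ) * q n := by positivity
      linarith
    rw [sum_range_succ'] at h2
    simpa using h2
  have h2 : ∑ i ∈ range n, ((i : ℝ) + 1) * q (i + 1) ≤
      ∑ i ∈ range n, (y * q i + 5 * y / n * (((i : ℝ) + 1) * q i)) := by
    refine sum_le_sum fun i _ => ?_
    have h3 := hr i
    have h4 : min (((i : ℝ) + 1) / n) 1 ≤ ((i : ℝ) + 1) / n := min_le_left _ _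
    have h5 := hq i
    calc ((i : ℝ) + 1) * q (i + 1)
        ≤ ((i : ℝ) + 1) * (q i * (y * (1 + 5 * (((i : ℝ) + 1) / n)) / (i + 1))) := by
          gcongr
          refine h3.trans ?_
          gcongr
      _ = _ := by field_simp
  rw [sum_add_distrib, ← mul_sum, ← mul_sum, hsum] at h2
  have h3 : ∑ i ∈ range n, ((i : ℝ) + 1) * q i = ∑ i ∈ range n, (i : ℝ) * q i + 1 := by
    simp only [add_mul, one_mul, sum_add_distrib, hsum]
  linarith

end Majorant

section Sampling

open Finset Topology
open scoped Classical

/-! ### The number of components of a sampled graph -/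

instance {V : Type*} [Countable V] : MeasurableSingletonClass (SimpleGraph V) where
  measurableSet_singleton G := by
    have : ({G} : Set (SimpleGraph V)) = SimpleGraph.Adj ⁻¹' {G.Adj} := by
      ext H
      simp only [Set.mem_singleton_iff, Set.mem_preimage, SimpleGraph.adj_inj]
    rw [this]
    exact SimpleGraph.measurable_adj (measurableSet_singleton _)

variable {n : ℕ} {τ : Weighting} {B : Set (SimpleGraph (Fin n))}

/-- The probability that a graph sampled from `B` has `i + 1` components. -/
noncomputable def componentProb (τ : Weighting) (B : Set (SimpleGraph (Fin n))) (i : ℕ) : ℝ :=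
  (∑ G ∈ slice B (i + 1), τ.weight G) / τ.totalWeight B

theorem componentProb_nonneg (hB : 0 < τ.totalWeight B) (i : ℕ) : 0 ≤ componentProb τ B i :=
  div_nonneg (sum_nonneg fun G _ => τ.weight_nonneg G) hB.le

theorem componentProb_eq_zero {i : ℕ} (hi : n ≤ i) : componentProb τ B i = 0 := by
  have : slice B (i + 1) = ∅ := by
    refine eq_empty_of_forall_notMem fun G hG => ?_
    have := numComponents_le_card G
    rw [(mem_slice.1 hG).2, Fintype.card_fin] at this
    omega
  rw [componentProb, this, sum_empty, zero_div]

theorem sum_weight_eq_sum_componentProb (hn : 0 < n) (φ : ℕ → ℝ) :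
    ∑ G ∈ (Set.toFinite B).toFinset, φ (numComponents G) * (τ.weight G / τ.totalWeight B) =
      ∑ i ∈ range n, φ (i + 1) * componentProb τ B i := by
  have : Nonempty (Fin n) := ⟨⟨0, hn⟩⟩
  rw [← sum_fiberwise_of_maps_to (t := range n) (g := fun G => numComponents G - 1)]
  · refine sum_congr rfl fun i _ => ?_
    have hs : {G ∈ (Set.toFinite B).toFinset | numComponents G - 1 = i} = slice B (i + 1) := by
      ext G
      have := numComponents_pos G
      simp only [mem_filter, Set.Finite.mem_toFinset, mem_slice]
      refine and_congr_right fun _ => ?_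
      omega
    rw [hs, componentProb, sum_div, mul_sum]
    exact sum_congr rfl fun G hG => by rw [(mem_slice.1 hG).2]
  · intro G _
    have h1 := numComponents_le_card G
    have h2 := numComponents_pos G
    rw [Fintype.card_fin] at h1
    rw [mem_range]
    omega

theorem sum_componentProb (hn : 0 < n) (hB : 0 < τ.totalWeight B) :
    ∑ i ∈ range n, componentProb τ B i = 1 := by
  have h := sum_weight_eq_sum_componentProb (τ := τ) (B := B) hn fun _ => 1
  simp only [one_mul] at h
  rw [← h, ← sum_div]
  exact div_self hB.ne'

theorem componentProb_succ_le {A : GraphSet} (hA : BridgeAlterable A) (hn : 0 < n)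
    (hB : 0 < τ.totalWeight (A n)) (i : ℕ) :
    componentProb τ (A n) (i + 1) ≤ componentProb τ (A n) i *
      (τ.nu / (2 * τ.lam) * (1 + 5 * min (((i : ℝ) + 1) / n) 1) / (i + 1)) := by
  have hn' : (0 : ℝ) < n := by exact_mod_cast hn
  have hlam := τ.lam_pos
  have hnu := τ.nu_pos
  by_cases hi : i + 1 ≤ n
  · have hmin : min (((i : ℝ) + 1) / n) 1 = ((i : ℝ) + 1) / n := by
      refine min_eq_left ((div_le_one hn').2 ?_)
      exact_mod_cast hi
    have h := sum_slice_succ_le τ hA hn (i + 1)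
    rw [hmin, componentProb, componentProb, div_mul_eq_mul_div]
    refine div_le_div_of_nonneg_right ?_ hB.le
    push_cast at h
    generalize ∑ F ∈ slice (A n) (i + 1 + 1), τ.weight F = a at h ⊢
    generalize ∑ F ∈ slice (A n) (i + 1), τ.weight F = b at h ⊢
    calc a = 2 * τ.lam * (i + 1) * a / (2 * τ.lam * (i + 1)) := by field_simp
      _ ≤ τ.nu * (1 + 5 * (i + 1) / n) * b / (2 * τ.lam * (i + 1)) := by gcongr
      _ = _ := by field_simp
  -- a graph on `n` vertices never has `i + 2 > n` components, so the cap is harmless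
  · rw [componentProb_eq_zero (by omega)]
    have := componentProb_nonneg hB i
    have : 0 ≤ min (((i : ℝ) + 1) / n) 1 := by positivity
    positivity

variable {Ω : Type*} [MeasurableSpace Ω] {P : Measure Ω} {R : Ω → SimpleGraph (Fin n)}

/-- The given probabilities already add up to `1`, so graphs outside `B` have probability `0`. -/
theorem IsSampledFrom.map_singleton [IsProbabilityMeasure P] (h : IsSampledFrom P τ B R)
    (G : SimpleGraph (Fin n)) :
    P.map R {G} = if G ∈ B then ENNReal.ofReal (τ.weight G / τ.totalWeight B) else 0 := by
  have hmap : ∀ H, P.map R {H} = P {ω | R ω = H} := fun H => by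
    rw [Measure.map_apply h.measurable (measurableSet_singleton H)]; rfl
  have := Measure.isProbabilityMeasure_map (μ := P) h.measurable.aemeasurable
  split_ifs with hG
  · rw [hmap, h.prob_eq G hG]
  · have h1 : P.map R B = 1 := by
      rw [← (Set.toFinite B).coe_toFinset, ← sum_measure_singleton]
      have h2 : ∀ H ∈ (Set.toFinite B).toFinset,
          P.map R {H} = ENNReal.ofReal (τ.weight H / τ.totalWeight B) := fun H hH => by
        rw [hmap, h.prob_eq H ((Set.Finite.mem_toFinset _).1 hH)]
      rw [sum_congr rfl h2, ← ENNReal.ofReal_sum_of_nonneg fun H _ =>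
        div_nonneg (τ.weight_nonneg H) h.totalWeight_pos.le, ← sum_div]
      have : (∑ H ∈ (Set.toFinite B).toFinset, τ.weight H) / τ.totalWeight B = 1 :=
        div_self h.totalWeight_pos.ne'
      rw [this, ENNReal.ofReal_one]
    have h2 : P.map R Bᶜ = 0 := by
      rw [prob_compl_eq_one_sub (Set.toFinite B).measurableSet, h1, tsub_self]
    exact measure_mono_null (Set.singleton_subset_iff.2 hG) h2

theorem IsSampledFrom.lintegral_numComponents [IsProbabilityMeasure P]
    (h : IsSampledFrom P τ B R) (hn : 0 < n) {φ : ℕ → ℝ} (hφ : ∀ k, 0 ≤ φ k) :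
    ∫⁻ ω, ENNReal.ofReal (φ (numComponents (R ω))) ∂P =
      ENNReal.ofReal (∑ i ∈ range n, φ (i + 1) * componentProb τ B i) := by
  have hm : Measurable fun G : SimpleGraph (Fin n) => ENNReal.ofReal (φ (numComponents G)) :=
    measurable_of_finite _
  rw [← lintegral_map hm h.measurable, lintegral_fintype]
  simp only [h.map_singleton, mul_ite, mul_zero]
  rw [← sum_weight_eq_sum_componentProb hn, ENNReal.ofReal_sum_of_nonneg fun G _ =>
    mul_nonneg (hφ _) (div_nonneg (τ.weight_nonneg G) h.totalWeight_pos.le), ← sum_filter]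
  refine sum_congr (by ext; simp) fun G _ => ?_
  rw [ENNReal.ofReal_mul (hφ _)]

theorem IsSampledFrom.prob_numComponents [IsProbabilityMeasure P]
    (h : IsSampledFrom P τ B R) (hn : 0 < n) (Q : ℕ → Prop) [DecidablePred Q] :
    P {ω | Q (numComponents (R ω))} =
      ENNReal.ofReal (∑ i ∈ range n with Q (i + 1), componentProb τ B i) := by
  have hS : MeasurableSet {ω | Q (numComponents (R ω))} :=
    h.measurable (Set.toFinite {G | Q (numComponents G)}).measurableSet
  have e := h.lintegral_numComponents hn (φ := fun k => if Q k then 1 else 0)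
    fun k => by split_ifs <;> norm_num
  simp only [ite_mul, one_mul, zero_mul, ← sum_filter] at e
  rw [← e, ← lintegral_indicator_one hS]
  refine lintegral_congr fun ω => ?_
  by_cases hω : Q (numComponents (R ω)) <;> simp [Set.indicator, hω]

theorem poissonMeasure_tail {y : ℝ} (hy : 0 < y) (r : ℕ) :
    poissonMeasure y.toNNReal {k | r ≤ k} =
      ENNReal.ofReal (1 - ∑ i ∈ range r, Real.exp (-y) * y ^ i / i.factorial) := by
  have h1 : {k | r ≤ k} = (↑(range r) : Set ℕ)ᶜ := by ext; simp
  rw [h1, prob_compl_eq_one_sub (range r).measurableSet, ← sum_measure_singleton,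
    ENNReal.ofReal_sub _ (sum_nonneg fun i _ => by positivity), ENNReal.ofReal_one,
    ENNReal.ofReal_sum_of_nonneg fun i _ => by positivity]
  simp only [poissonMeasure_singleton, Real.coe_toNNReal _ hy.le]

end Sampling

end BridgeGraph

open BridgeGraph in
theorem mainTheorem1 (A : BridgeGraph.GraphSet) (hA : BridgeGraph.BridgeAlterable A)
    (τ : BridgeGraph.Weighting)
    (Ω : ℕ → Type*) [∀ n, MeasurableSpace (Ω n)]
    (P : (n : ℕ) → Measure (Ω n)) [∀ n, IsProbabilityMeasure (P n)]
    (R : (n : ℕ) → Ω n → SimpleGraph (Fin n))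
    (hR : ∀ᶠ n in atTop, BridgeGraph.IsSampledFrom (P n) τ (A n) (R n)) :
    BridgeGraph.AsymptoticallyStochLE P (fun n ω => BridgeGraph.numComponents (R n ω))
      (poissonMeasure (τ.nu / (2 * τ.lam)).toNNReal) (fun k => 1 + k) ∧
    ENNReal.ofReal (Real.exp (-(τ.nu / (2 * τ.lam)))) ≤
      liminf (fun n => P n {ω | (R n ω).Connected}) atTop ∧
    limsup (fun n => ∫⁻ ω, (BridgeGraph.numComponents (R n ω) : ℝ≥0∞) ∂(P n)) atTop ≤
      ENNReal.ofReal (1 + τ.nu / (2 * τ.lam)) := by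
  have hlam := τ.lam_pos
  have hnu := τ.nu_pos
  have hy : 0 < τ.nu / (2 * τ.lam) := by positivity
  have hq := fun {n : ℕ} (h : IsSampledFrom (P n) τ (A n) (R n)) =>
    componentProb_nonneg h.totalWeight_pos
  have hr := fun {n : ℕ} (hn : 0 < n) (h : IsSampledFrom (P n) τ (A n) (R n)) =>
    componentProb_succ_le hA hn h.totalWeight_pos
  have hsum := fun {n : ℕ} (hn : 0 < n) (h : IsSampledFrom (P n) τ (A n) (R n)) =>
    sum_componentProb hn h.totalWeight_pos
  set y := τ.nu / (2 * τ.lam)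
  refine ⟨fun t => ?_, ?_, ?_⟩
  · obtain _ | r := t
    · have h0 : {k : ℕ | 0 ≤ 1 + k} = Set.univ := by ext; simp
      rw [h0, measure_univ]
      exact limsup_le_of_le (h := .of_forall fun n => prob_le_one)
    · have h0 : {k : ℕ | r + 1 ≤ 1 + k} = {k | r ≤ k} := by ext; simp; omega
      rw [h0, poissonMeasure_tail hy,
        ← (ENNReal.tendsto_ofReal (tendsto_one_sub_majorant_ratio hy r)).limsup_eq]
      refine limsup_le_limsup ?_
      filter_upwards [hR, eventually_gt_atTop 0, eventually_ge_atTop r] with n h hn hrn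
      rw [h.prob_numComponents hn (r + 1 ≤ ·)]
      refine ENNReal.ofReal_le_ofReal (le_trans (le_of_eq ?_)
        (tail_le hy (hq h) (hr hn h) (hsum hn h) hrn))
      refine Finset.sum_congr ?_ fun _ _ => rfl
      ext; simp; omega
  -- `Pr(κ = 1) = 1 - Pr(κ ≥ 2)`, and the first majorant weight is `1`
  · have hlim := (tendsto_one_sub_majorant_ratio hy 1).const_sub 1
    simp only [Finset.range_one, Finset.sum_singleton, pow_zero, Nat.factorial_zero, Nat.cast_one,
      mul_one, div_one, sub_sub_cancel] at hlim
    rw [← (ENNReal.tendsto_ofReal hlim).liminf_eq]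
    refine liminf_le_liminf ?_
    filter_upwards [hR, eventually_gt_atTop 0] with n h hn
    have h1 := tail_le hy (hq h) (hr hn h) (hsum hn h) (r := 1) hn
    have h2 := hsum hn h
    rw [← Finset.sum_range_add_sum_Ico _ (Nat.succ_le_of_lt hn)] at h2
    simp only [Nat.succ_eq_add_one, zero_add, Finset.range_one, Finset.sum_singleton] at h1 h2
    simp only [connected_iff_numComponents]
    rw [h.prob_numComponents hn (· = 1)]
    refine ENNReal.ofReal_le_ofReal ?_
    have h3 : (Finset.range n).filter (fun i => i + 1 = 1) = {0} := by
      ext i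
      simp only [Finset.mem_filter, Finset.mem_range, Finset.mem_singleton]
      omega
    rw [h3, Finset.sum_singleton]
    linarith
  · have hlim : Tendsto (fun n : ℕ => (1 + y) / (1 - 5 * y / n)) atTop (nhds (1 + y)) := by
      have h1 : Tendsto (fun n : ℕ => 5 * y / (n : ℝ)) atTop (nhds 0) :=
        tendsto_const_div_atTop_nhds_zero_nat _
      simpa [div_eq_mul_inv] using ((h1.const_sub 1).inv₀ (by norm_num)).const_mul (1 + y)
    rw [← (ENNReal.tendsto_ofReal hlim).limsup_eq]
    refine limsup_le_limsup ?_
    have hlarge : ∀ᶠ n : ℕ in atTop, 5 * y < n :=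
      tendsto_natCast_atTop_atTop.eventually_gt_atTop _
    filter_upwards [hR, eventually_gt_atTop 0, hlarge] with n h hn hl
    have hn' : (0 : ℝ) < n := by exact_mod_cast hn
    have e := h.lintegral_numComponents hn (φ := fun k => (k : ℝ)) fun k => Nat.cast_nonneg k
    simp only [ENNReal.ofReal_natCast] at e
    rw [e]
    refine ENNReal.ofReal_le_ofReal ?_
    have hpos : 0 < 1 - 5 * y / n := sub_pos.2 ((div_lt_one hn').2 hl)
    rw [le_div_iff₀ hpos]
    simpa using mean_le hn hy (hq h) (hr hn h) (hsum hn h)
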